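/- For points $x=(x_1,x_2)\in\mathbb{R}^2$ write $\widehat{x}=(x_1,x_2,1)^\top$. A configuration of five point pairs is $\mathcal{P}=((u_i,v_i))_{i=1,\dots,5}$ with $u_i,v_i\in\mathbb{R}^2$, the $u_i$ pairwise distinct and the $v_i$ pairwise distinct. The space of all such configurations is a subset of the affine space $(\mathbb{R}^2\times\mathbb{R}^2)^5=\mathbb{R}^{20}$ and carries the subspace topology of the Zariski topology of $\mathbb{R}^{20}$, whose closed sets are the sets of common zeros of real polynomials. A camera is a real $3\times4$ matrix $A=[\,G\;\;t\,]$ of rank three (up to scale), with $G\in\mathbb{R}^{3\times3}$ and $t\in\mathbb{R}^3$; its center is the point $c_A\in\mathbb{P}^3_{\mathbb{R}}$ with $Ac_A=0$, and it is finite if the last coordinate of $c_A$ is non-zero (equivalently $\det G\neq0$). Its principal ray is $n_A=\det(G)\,A_{3,\bullet}^\top$, where $A_{3,\bullet}$ is the third row of $A$. Let $n_\infty=(0,0,0,1)^\top$. A chiral reconstruction of $\mathcal{P}$ consists of two finite cameras $A_1,A_2$ with distinct centers, points $q_1,\dots,q_5\in\mathbb{P}^3_{\mathbb{R}}$ and non-zero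 real scalars $w_{1i},w_{2i}$ such that, for all $i$, $A_1q_i=w_{1i}\widehat{u_i}$, $A_2q_i=w_{2i}\widehat{v_i}$, and $$(n_\infty^\top q_i)(n_{A_1}^\top q_i)\ge0,\qquad (n_\infty^\top q_i)(n_{A_2}^\top q_i)\ge0,\qquad (n_{A_1}^\top q_i)(n_{A_2}^\top q_i)\ge0 .$$ (These conditions do not depend on the representatives chosen for the $A_j$ and the $q_i$.) Theorem. The set of configurations of five point pairs that have no chiral reconstruction is Zariski dense in the space of all configurations of five point pairs. -/

import Mathlib

open scoped Matrix

/-! ### Configurations of point pairs -/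

/-- A configuration of `k` point pairs `(uᵢ, vᵢ)` of finite points of the real projective plane,
given by their affine coordinates; the `uᵢ` are pairwise distinct and so are the `vᵢ`. -/
@[ext]
structure PointPairs (k : ℕ) where
  /-- affine coordinates of the points in the first image -/
  u : Fin k → Fin 2 → ℝ
  /-- affine coordinates of the points in the second image -/
  v : Fin k → Fin 2 → ℝ
  u_injective : Function.Injective u
  v_injective : Function.Injective v

/-- The homogenization `(x₀, x₁, 1)` of a point of the affine plane. -/
def homogenize (x : Fin 2 → ℝ) : Fin 3 → ℝ := ![x 0, x 1, 1]

/-! ### Cameras -/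

/-- A representative of a projective camera: a real `3 × 4` matrix. -/
abbrev CameraMatrix := Matrix (Fin 3) (Fin 4) ℝ

namespace CameraMatrix

/-- The left `3 × 3` block `G` of a camera `A = [G t]`. -/
def leftBlock (A : CameraMatrix) : Matrix (Fin 3) (Fin 3) ℝ := A.submatrix id Fin.castSucc

/-- The representative of the camera center given by Cramer's rule: the coordinate `j` is the
signed `3 × 3` minor of `A` obtained by dropping the column `j`; the last coordinate is `det G`. -/
noncomputable def center (A : CameraMatrix) : Fin 4 → ℝ :=
  fun j => (-1) ^ ((j : ℕ) + 1) * (A.submatrix id j.succAbove).det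

theorem mulVec_center (A : CameraMatrix) : A *ᵥ A.center = 0 := by
  funext i
  fin_cases i <;>
    simp [Matrix.mulVec, dotProduct, center, Fin.sum_univ_four, Matrix.det_fin_three,
      Fin.succAbove] <;> ring

/-- The normal vector `(0, 0, 0, 1)` of the plane at infinity. -/
def normalAtInfinity : Fin 4 → ℝ := ![0, 0, 0, 1]

/-- A camera is finite if its center does not lie on the plane at infinity. -/
def IsFinite (A : CameraMatrix) : Prop := normalAtInfinity ⬝ᵥ A.center ≠ 0

theorem isFinite_iff (A : CameraMatrix) : A.IsFinite ↔ A.leftBlock.det ≠ 0 := by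
  simp [IsFinite, normalAtInfinity, dotProduct, center, Fin.sum_univ_four, Matrix.det_fin_three,
    Fin.succAbove, leftBlock]

/-- The principal ray `det(G) · A₃` of a camera, where `A₃` is the third row. -/
noncomputable def principalRay (A : CameraMatrix) : Fin 4 → ℝ := A.leftBlock.det • A 2

end CameraMatrix

/-! ### Projective and chiral reconstructions

Points of projective space and cameras are given by representatives; all the conditions below are
invariant under nonzero rescaling of the cameras and of the world points. -/

namespace PointPairs

variable {k : ℕ}

/-- A projective reconstruction: two cameras of rank three, world points `qᵢ` of the real
projective 3-space, and nonzero scalars with `A₁ qᵢ = w₁ᵢ uᵢ` and `A₂ qᵢ = w₂ᵢ vᵢ`. -/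
structure ProjectiveReconstruction (P : PointPairs k) where
  A₁ : CameraMatrix
  A₂ : CameraMatrix
  rank_A₁ : A₁.rank = 3
  rank_A₂ : A₂.rank = 3
  q : Fin k → Fin 4 → ℝ
  q_ne_zero : ∀ i, q i ≠ 0
  w₁ : Fin k → ℝ
  w₂ : Fin k → ℝ
  w₁_ne_zero : ∀ i, w₁ i ≠ 0
  w₂_ne_zero : ∀ i, w₂ i ≠ 0
  image₁ : ∀ i, A₁ *ᵥ q i = w₁ i • homogenize (P.u i)
  image₂ : ∀ i, A₂ *ᵥ q i = w₂ i • homogenize (P.v i)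

/-- A projective reconstruction is chiral if its cameras are finite with distinct centers (as
points of projective space) and every world point lies in the chiral domain of the cameras. -/
structure ProjectiveReconstruction.IsChiral {P : PointPairs k}
    (R : P.ProjectiveReconstruction) : Prop where
  finite₁ : R.A₁.IsFinite
  finite₂ : R.A₂.IsFinite
  nonCoincident : LinearIndependent ℝ ![R.A₁.center, R.A₂.center]
  infinity_one : ∀ i,
    0 ≤ (CameraMatrix.normalAtInfinity ⬝ᵥ R.q i) * (R.A₁.principalRay ⬝ᵥ R.q i)
  infinity_two : ∀ i,
    0 ≤ (CameraMatrix.normalAtInfinity ⬝ᵥ R.q i) * (R.A₂.principalRay ⬝ᵥ R.q i)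
  one_two : ∀ i, 0 ≤ (R.A₁.principalRay ⬝ᵥ R.q i) * (R.A₂.principalRay ⬝ᵥ R.q i)

/-- The configuration admits a chiral reconstruction. -/
def HasChiralReconstruction (P : PointPairs k) : Prop :=
  ∃ R : P.ProjectiveReconstruction, R.IsChiral

end PointPairs

/-! ### The Zariski topology -/

/-- The set of common zeros in `ℝ^σ` of a set of real polynomials. -/
def polynomialZeros {σ : Type*} (S : Set (MvPolynomial σ ℝ)) : Set (σ → ℝ) :=
  {x | ∀ p ∈ S, MvPolynomial.eval x p = 0}

/-- The Zariski topology on the affine space `ℝ^σ`: the closed sets are the sets of common zeros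
of real polynomials. -/
@[reducible]
def zariskiTopology (σ : Type*) : TopologicalSpace (σ → ℝ) :=
  TopologicalSpace.ofClosed (Set.range polynomialZeros)
    ⟨{1}, by ext x; simp [polynomialZeros]⟩
    (by
      intro A hA
      refine ⟨{p | ∃ S, polynomialZeros S ∈ A ∧ p ∈ S}, ?_⟩
      ext x
      simp only [polynomialZeros, Set.mem_ofPred_eq, Set.mem_sInter]
      constructor
      · intro h Z hZ
        obtain ⟨S, rfl⟩ := hA hZ
        exact fun p hp => h p ⟨S, hZ, hp⟩
      · rintro h p ⟨S, hS, hp⟩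
        exact h _ hS p hp)
    (by
      rintro _ ⟨S, rfl⟩ _ ⟨T, rfl⟩
      refine ⟨{r | ∃ p ∈ S, ∃ q ∈ T, r = p * q}, ?_⟩
      ext x
      simp only [polynomialZeros, Set.mem_ofPred_eq, Set.mem_union]
      constructor
      · intro h
        by_contra! hc
        obtain ⟨⟨p, hp, hpx⟩, q, hq, hqx⟩ := hc
        have := h _ ⟨p, hp, q, hq, rfl⟩
        simp [hpx, hqx] at this
      · rintro (h | h) _ ⟨p, hp, q, hq, rfl⟩
        · simp [h p hp]
        · simp [h q hq])

namespace PointPairs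

/-- The `4k` affine coordinates of a configuration: `(i, 0, j)` is the coordinate `j` of `uᵢ` and
`(i, 1, j)` is the coordinate `j` of `vᵢ`. -/
def coordinates {k : ℕ} (P : PointPairs k) : Fin k × Fin 2 × Fin 2 → ℝ :=
  fun a => ![P.u a.1 a.2.2, P.v a.1 a.2.2] a.2.1

/-- The Zariski topology on the space of all configurations of `k` point pairs, which is a subspace
of the affine space of dimension `4k`. -/
@[reducible]
def zariski (k : ℕ) : TopologicalSpace (PointPairs k) :=
  TopologicalSpace.induced coordinates (zariskiTopology (Fin k × Fin 2 × Fin 2))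

end PointPairs

/-! ### Sign patterns of linear dependencies -/

/-! Five world points in `ℝ⁴` satisfy a relation `∑ aᵢ qᵢ = 0`. Applying both cameras gives
dependencies of the homogenized `uᵢ` and `vᵢ` with coefficients `aᵢ w₁ᵢ` and `aᵢ w₂ᵢ`; chirality
makes the sign of `w₁ᵢ w₂ᵢ` independent of `i`, so up to a global sign both have the same sign
pattern. Let the `uᵢ` be a convex pentagon in cyclic order and the `vᵢ` one in pentagram order. Each
edge gives a relation with positive coefficients among the three remaining entries, and the two
pentagons together have all ten pairs as edges. No nonzero sign pattern survives
(`eq_zero_of_dependencies`). Such pairs of pentagons form a nonempty Euclidean open set, on which no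
nonzero polynomial vanishes identically; hence Zariski density. -/

/-- A dependency that is positive on the complement of `{i, j}` and zero on `{i, j}` forces
a nonnegative family on that complement to vanish there. -/
theorem eq_zero_of_sum_mul_eq_zero {ι : Type*} [Fintype ι] {i j : ι} {α c : ι → ℝ}
    (hα : ∀ k, k ≠ i → k ≠ j → 0 < α k) (hi : α i = 0) (hj : α j = 0)
    (hsum : ∑ k, α k * c k = 0) (hc : ∀ k, k ≠ i → k ≠ j → 0 ≤ c k) :
    ∀ k, k ≠ i → k ≠ j → c k = 0 := by
  have hnonneg : ∀ k ∈ Finset.univ, 0 ≤ α k * c k := by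
    intro k _
    by_cases hki : k = i
    · simp [hki, hi]
    by_cases hkj : k = j
    · simp [hkj, hj]
    exact mul_nonneg (hα k hki hkj).le (hc k hki hkj)
  intro k hki hkj
  have := (Finset.sum_eq_zero_iff_of_nonneg hnonneg).1 hsum k (Finset.mem_univ k)
  exact (mul_eq_zero.1 this).resolve_left (hα k hki hkj).ne'

/-- Five numbers, every three of which satisfy a linear relation with positive coefficients,
are all zero. -/
theorem eq_zero_of_positive_relations {c : Fin 5 → ℝ}
    (h : ∀ i j, i ≠ j → ∃ α : Fin 5 → ℝ, (∀ k, k ≠ i → k ≠ j → 0 < α k) ∧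
      α i = 0 ∧ α j = 0 ∧ ∑ k, α k * c k = 0) : c = 0 := by
  -- Among five signs three agree; `i`, `j` are the other two labels.
  have hpigeon : ∀ s : Fin 5 → Bool, ∃ i j, i ≠ j ∧
      ((∀ k, k ≠ i → k ≠ j → s k = true) ∨ (∀ k, k ≠ i → k ≠ j → s k = false)) := by
    decide
  have hvanish : ∃ i j, i ≠ j ∧ ∀ k, k ≠ i → k ≠ j → c k = 0 := by
    obtain ⟨i, j, hij, hs | hs⟩ := hpigeon fun k => decide (0 ≤ c k)
    all_goals
      refine ⟨i, j, hij, ?_⟩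
      obtain ⟨α, hα, hi, hj, hsum⟩ := h i j hij
    · exact eq_zero_of_sum_mul_eq_zero hα hi hj hsum
        fun k hki hkj => of_decide_eq_true (hs k hki hkj)
    · have hneg := eq_zero_of_sum_mul_eq_zero (c := -c) hα hi hj (by simpa using hsum)
        fun k hki hkj => by
          have := of_decide_eq_false (hs k hki hkj)
          simp only [Pi.neg_apply]
          linarith
      exact fun k hki hkj => neg_eq_zero.1 (hneg k hki hkj)
  obtain ⟨i, j, hij, hzero⟩ := hvanish
  have hthird : ∀ i j : Fin 5, ∃ k, k ≠ i ∧ k ≠ j := by decide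
  obtain ⟨m, hmi, hmj⟩ := hthird i j
  -- The relation omitting `m` and `b` involves `c a` and two entries already known to vanish.
  have hlast : ∀ a b : Fin 5, a ≠ b → m ≠ a → m ≠ b →
      (∀ k, k ≠ a → k ≠ b → c k = 0) → c a = 0 := by
    intro a b hab hma hmb hz
    obtain ⟨α, hα, hm, hb, hsum⟩ := h m b hmb
    rw [Finset.sum_eq_single a] at hsum
    · exact (mul_eq_zero.1 hsum).resolve_left (hα a hma.symm hab).ne'
    · intro k _ hka
      by_cases hkb : k = b
      · simp [hkb, hb]
      · simp [hz k hka hkb]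
    · simp
  funext k
  by_cases hki : k = i
  · exact hki ▸ hlast i j hij hmi hmj hzero
  by_cases hkj : k = j
  · exact hkj ▸ hlast j i hij.symm hmj hmi fun k h₁ h₂ => hzero k h₂ h₁
  exact hzero k hki hkj

/-! ### Orientations of triples of points in the plane -/

/-- Twice the signed area of the triangle with vertices `p i`, `p j`, `p k`. -/
def orientation {ι : Type*} (p : ι → Fin 2 → ℝ) (i j k : ι) : ℝ :=
  (p j 0 - p i 0) * (p k 1 - p i 1) - (p j 1 - p i 1) * (p k 0 - p i 0)

theorem orientation_self_left {ι : Type*} (p : ι → Fin 2 → ℝ) (i j : ι) :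
    orientation p i j i = 0 := by
  simp [orientation]

theorem orientation_self_right {ι : Type*} (p : ι → Fin 2 → ℝ) (i j : ι) :
    orientation p i j j = 0 := by
  simp only [orientation]
  ring

/-- The orientation is the determinant of the three homogenized points, hence a linear functional of
the last one. -/
theorem sum_orientation_mul_eq_zero {ι : Type*} [Fintype ι] {p : ι → Fin 2 → ℝ} {c : ι → ℝ}
    (hc : ∑ k, c k • homogenize (p k) = 0) (i j : ι) :
    ∑ k, orientation p i j k * c k = 0 := by
  have h₀ : ∑ k, c k * p k 0 = 0 := by simpa [homogenize] using congrFun hc 0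
  have h₁ : ∑ k, c k * p k 1 = 0 := by simpa [homogenize] using congrFun hc 1
  have h₂ : ∑ k, c k = 0 := by simpa [homogenize] using congrFun hc 2
  calc ∑ k, orientation p i j k * c k
      = (p j 0 - p i 0) * (∑ k, c k * p k 1) - (p j 1 - p i 1) * (∑ k, c k * p k 0)
        + ((p j 1 - p i 1) * p i 0 - (p j 0 - p i 0) * p i 1) * ∑ k, c k := by
        simp only [Finset.mul_sum, ← Finset.sum_sub_distrib, ← Finset.sum_add_distrib]
        refine Finset.sum_congr rfl fun k _ => ?_
        simp only [orientation]
        ring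
    _ = 0 := by simp [h₀, h₁, h₂]

/-- The points `p 0, p s, p (2 s), …` are the vertices of a convex pentagon in counterclockwise
order: every other point lies to the left of the edge from `p i` to `p (i + s)`. -/
def IsConvexPentagon (s : Fin 5) (p : Fin 5 → Fin 2 → ℝ) : Prop :=
  ∀ i k, k ≠ i → k ≠ i + s → 0 < orientation p i (i + s) k

theorem IsConvexPentagon.injective {s : Fin 5} {p : Fin 5 → Fin 2 → ℝ}
    (hp : IsConvexPentagon s p) : Function.Injective p := by
  intro a b hab
  by_contra hne
  -- Coinciding points make an edge degenerate in the first case, and put `p b` on the line of an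
  -- edge from `p a` in the second.
  by_cases h : b = a + s
  · have hthird : ∀ i j : Fin 5, ∃ k, k ≠ i ∧ k ≠ j := by decide
    obtain ⟨k, hka, hkb⟩ := hthird a (a + s)
    have := hp a k hka hkb
    simp [orientation, ← h, hab] at this
  · have := hp a b (Ne.symm hne) h
    simp [orientation, hab] at this

/-- Every pair of labels is an edge of the pentagon with step `1` or of that with step `2`, so a
convex pentagon and one traversed in pentagram order share no sign pattern of a dependency. -/
theorem eq_zero_of_dependencies {u v : Fin 5 → Fin 2 → ℝ} (hu : IsConvexPentagon 1 u)
    (hv : IsConvexPentagon 2 v) {c μ : Fin 5 → ℝ} (hμ : ∀ k, 0 < μ k)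
    (hcu : ∑ k, c k • homogenize (u k) = 0)
    (hcv : ∑ k, (μ k * c k) • homogenize (v k) = 0) : c = 0 := by
  refine eq_zero_of_positive_relations fun i j hij => ?_
  have hU : ∀ i : Fin 5, ∃ α : Fin 5 → ℝ, (∀ k, k ≠ i → k ≠ i + 1 → 0 < α k) ∧
      α i = 0 ∧ α (i + 1) = 0 ∧ ∑ k, α k * c k = 0 := fun i =>
    ⟨orientation u i (i + 1), hu i, orientation_self_left _ _ _, orientation_self_right _ _ _,
      sum_orientation_mul_eq_zero hcu _ _⟩
  have hV : ∀ i : Fin 5, ∃ α : Fin 5 → ℝ, (∀ k, k ≠ i → k ≠ i + 2 → 0 < α k) ∧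
      α i = 0 ∧ α (i + 2) = 0 ∧ ∑ k, α k * c k = 0 := fun i =>
    ⟨fun k => orientation v i (i + 2) k * μ k, fun k h₁ h₂ => mul_pos (hv i k h₁ h₂) (hμ k),
      by simp [orientation_self_left], by simp [orientation_self_right],
      by simpa only [mul_assoc] using sum_orientation_mul_eq_zero hcv i (i + 2)⟩
  have hedge : ∀ i j : Fin 5, i ≠ j → j = i + 1 ∨ i = j + 1 ∨ j = i + 2 ∨ i = j + 2 := by decide
  rcases hedge i j hij with rfl | rfl | rfl | rfl
  · exact hU i
  · obtain ⟨α, hα, h₁, h₂, hsum⟩ := hU j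
    exact ⟨α, fun k hk₁ hk₂ => hα k hk₂ hk₁, h₂, h₁, hsum⟩
  · exact hV i
  · obtain ⟨α, hα, h₁, h₂, hsum⟩ := hV j
    exact ⟨α, fun k hk₁ hk₂ => hα k hk₂ hk₁, h₂, h₁, hsum⟩

/-! ### Configurations without a chiral reconstruction -/

theorem CameraMatrix.principalRay_dotProduct {A : CameraMatrix} {q : Fin 4 → ℝ} {w : ℝ}
    {x : Fin 2 → ℝ} (h : A *ᵥ q = w • homogenize x) :
    A.principalRay ⬝ᵥ q = A.leftBlock.det * w := by
  have h₂ : A 2 ⬝ᵥ q = w := by simpa [Matrix.mulVec, homogenize] using congrFun h 2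
  simp [principalRay, h₂]

theorem Matrix.mulVec_eq_zero_of_dependency {ι m n : Type*} [Fintype ι] [Fintype n]
    {A : Matrix m n ℝ} {q : ι → n → ℝ} {a w : ι → ℝ} {y : ι → m → ℝ}
    (ha : ∑ i, a i • q i = 0) (h : ∀ i, A *ᵥ q i = w i • y i) :
    ∑ i, (a i * w i) • y i = 0 := by
  have := congrArg (A *ᵥ ·) ha
  simpa [Matrix.mulVec_sum, Matrix.mulVec_smul, h, smul_smul] using this

theorem PointPairs.not_hasChiralReconstruction {P : PointPairs 5}
    (hu : IsConvexPentagon 1 P.u) (hv : IsConvexPentagon 2 P.v) :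
    ¬ P.HasChiralReconstruction := by
  rintro ⟨R, hR⟩
  have hdep : ¬ LinearIndependent ℝ R.q := fun h => by
    simpa using h.fintype_card_le_finrank
  obtain ⟨a, ha, m, hm⟩ := Fintype.not_linearIndependent_iff.1 hdep
  set δ := R.A₁.leftBlock.det * R.A₂.leftBlock.det with hδ
  have hδ_ne : δ ≠ 0 := mul_ne_zero ((CameraMatrix.isFinite_iff _).1 hR.finite₁)
    ((CameraMatrix.isFinite_iff _).1 hR.finite₂)
  have hpos : ∀ k, 0 < δ * (R.w₁ k * R.w₂ k) := by
    intro k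
    have h := hR.one_two k
    rw [CameraMatrix.principalRay_dotProduct (R.image₁ k),
      CameraMatrix.principalRay_dotProduct (R.image₂ k)] at h
    -- Chirality is a weak inequality; nonzero scalars make it strict.
    refine lt_of_le_of_ne (by rw [hδ]; linarith) (Ne.symm ?_)
    exact mul_ne_zero hδ_ne (mul_ne_zero (R.w₁_ne_zero k) (R.w₂_ne_zero k))
  have hc : (fun k => a k * R.w₁ k) = 0 := by
    -- This `μ k` is `δ * w₂ k / w₁ k`, written to be visibly positive; then `μ k * c k = δ * a k *
    -- w₂ k`.
    refine eq_zero_of_dependencies hu hv (μ := fun k => δ * (R.w₁ k * R.w₂ k) / R.w₁ k ^ 2)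
      (fun k => div_pos (hpos k) (sq_pos_of_ne_zero (R.w₁_ne_zero k)))
      (Matrix.mulVec_eq_zero_of_dependency ha R.image₁) ?_
    have h₂ := congrArg (δ • ·) (Matrix.mulVec_eq_zero_of_dependency ha R.image₂)
    simp only [Finset.smul_sum, smul_smul, smul_zero] at h₂
    rw [← h₂]
    refine Finset.sum_congr rfl fun k _ => ?_
    have := R.w₁_ne_zero k
    congr 1
    field_simp
  exact mul_ne_zero hm (R.w₁_ne_zero m) (congrFun hc m)

/-! ### Zariski density of open sets -/

theorem MvPolynomial.exists_eval_ne_zero_of_isOpen {σ : Type*} [Finite σ]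
    {p : MvPolynomial σ ℝ} (hp : p ≠ 0) {U : Set (σ → ℝ)} (hU : IsOpen U) (hne : U.Nonempty) :
    ∃ x ∈ U, MvPolynomial.eval x p ≠ 0 := by
  cases nonempty_fintype σ
  obtain ⟨x₀, hx₀⟩ := hne
  obtain ⟨ε, hε, hball⟩ := Metric.isOpen_iff.1 hU x₀ hx₀
  by_contra! hzero
  -- A sup-norm ball is a product of intervals, which are infinite sets.
  refine hp (MvPolynomial.funext_set (fun i => Metric.ball (x₀ i) ε) (fun i => ?_) fun x hx => ?_)
  · rw [Real.ball_eq_Ioo]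
    exact Set.Ioo_infinite (by linarith)
  · rw [hzero x (hball ?_), map_zero]
    rwa [ball_pi _ hε]

/-- A set of configurations that contains every configuration with coordinates in a nonempty open
set, in the Euclidean topology, is Zariski dense. -/
theorem PointPairs.dense_zariski_of_isOpen {k : ℕ} {S : Set (PointPairs k)}
    {U : Set (Fin k × Fin 2 × Fin 2 → ℝ)} (hU : IsOpen U) (hne : U.Nonempty)
    (h : ∀ x ∈ U, ∃ P ∈ S, P.coordinates = x) :
    @Dense (PointPairs k) (PointPairs.zariski k) S := by
  let := PointPairs.zariski k
  refine dense_iff_inter_open.2 ?_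
  rintro _ ⟨V, hV, rfl⟩ ⟨Q, hQ⟩
  obtain ⟨T, hT⟩ := hV
  have hmem : ∀ x, x ∈ V ↔ ∃ p ∈ T, MvPolynomial.eval x p ≠ 0 := by
    intro x
    rw [← not_iff_not, ← Set.mem_compl_iff, ← hT]
    simp [polynomialZeros]
  obtain ⟨p, hpT, hp⟩ := (hmem _).1 hQ
  obtain ⟨x, hxU, hx⟩ := MvPolynomial.exists_eval_ne_zero_of_isOpen
    (p := p) (by rintro rfl; simp at hp) hU hne
  obtain ⟨P, hPS, rfl⟩ := h x hxU
  exact ⟨P, (hmem _).2 ⟨p, hpT, hx⟩, hPS⟩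

theorem isOpen_setOf_isConvexPentagon {X : Type*} [TopologicalSpace X] (s : Fin 5)
    {p : X → Fin 5 → Fin 2 → ℝ} (hp : Continuous p) :
    IsOpen {x | IsConvexPentagon s (p x)} := by
  simp only [IsConvexPentagon, Set.ofPred_forall]
  refine isOpen_iInter_of_finite fun i => isOpen_iInter_of_finite fun k =>
    isOpen_iInter_of_finite fun _ => isOpen_iInter_of_finite fun _ =>
      isOpen_lt continuous_const ?_
  unfold orientation
  fun_prop

/-- Points `(t, t ^ 2)` on a parabola form a convex pentagon if the signs of the differences of the
parameters allow it. -/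
theorem isConvexPentagon_parabola {s : Fin 5} {t : Fin 5 → ℤ}
    (ht : ∀ i k, k ≠ i → k ≠ i + s → 0 < (t (i + s) - t i) * (t k - t i) * (t k - t (i + s))) :
    IsConvexPentagon s fun i => ![(t i : ℝ), (t i : ℝ) ^ 2] := by
  intro i k hki hks
  have h : (0 : ℝ) < ((t (i + s) - t i) * (t k - t i) * (t k - t (i + s)) : ℤ) := by
    exact_mod_cast ht i k hki hks
  -- On the parabola the orientation is a Vandermonde determinant.
  refine h.trans_eq ?_
  push_cast
  simp only [orientation, Matrix.cons_val_zero, Matrix.cons_val_one]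
  ring

theorem mainTheorem3 :
    @Dense (PointPairs 5) (PointPairs.zariski 5)
      {P : PointPairs 5 | ¬ P.HasChiralReconstruction} := by
  refine PointPairs.dense_zariski_of_isOpen
    (U := {x | IsConvexPentagon 1 (fun i j => x (i, 0, j))} ∩
      {x | IsConvexPentagon 2 (fun i j => x (i, 1, j))})
    ((isOpen_setOf_isConvexPentagon 1 (by fun_prop)).inter
      (isOpen_setOf_isConvexPentagon 2 (by fun_prop))) ?_ ?_
  · obtain ⟨u, hu⟩ : ∃ u, IsConvexPentagon 1 u :=
      ⟨_, isConvexPentagon_parabola (t := ![0, 1, 2, 3, 4]) (by decide)⟩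
    -- The labels `0, 2, 4, 1, 3` receive the increasing parameters `0, 1, 2, 3, 4`.
    obtain ⟨v, hv⟩ : ∃ v, IsConvexPentagon 2 v :=
      ⟨_, isConvexPentagon_parabola (t := ![0, 3, 1, 4, 2]) (by decide)⟩
    exact ⟨fun a => ![u a.1 a.2.2, v a.1 a.2.2] a.2.1, hu, hv⟩
  · rintro x ⟨hu, hv⟩
    refine ⟨⟨_, _, hu.injective, hv.injective⟩,
      PointPairs.not_hasChiralReconstruction hu hv, ?_⟩
    funext ⟨i, s, j⟩
    fin_cases s <;> rfl
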